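/- \textbf{Corollary 7 (Solecki, dual).} Let $\mathbf{Fin}$ be the category of finite sets and functions, and let $(\mathbf{Fin},\le^*)$ be the category whose objects are the finite linear orders and whose morphisms $L\to K$ are the rigid surjections, i.e. the surjections $s\colon L\to K$ such that the image of every initial segment of $L$ is an initial segment of $K$. Let $G\colon(\mathbf{Fin},\le^*)^{\mathrm{op}}\to\mathbf{Fin}^{\mathrm{op}}$ be the functor with $G(K,\le)=K$ and $G(f)=f$. For a category $\mathcal C$, a $\mathcal C$-language $\mathcal L$ consists of a set of function symbols, each with an arity $(r,s)\in\mathrm{Ob}(\mathcal C)^2$, and a set of relation symbols, each with an arity $r\in\mathrm{Ob}(\mathcal C)$. An $\mathcal L$-structure $\mathsf X$ is an object $X$ of $\mathcal C$ together with a set $R^{\mathsf X}\subseteq\mathrm{Hom}_{\mathcal C}(r,X)$ for every relation symbol $R$ of arity $r$ and a function $F^{\mathsf X}\colon\mathrm{Hom}_{\mathcal C}(X,r)\to\mathrm{Hom}_{\mathcal C}(X,s)$ for every function symbol $F$ of arity $(r,s)$. (For $\mathcal C=\mathbf{Fin}^{\mathrm{op}}$ this means that $R^{\mathsf X}$ is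 a set of functions $X\to r$ and that $F^{\mathsf X}$ is a function $X^r\to X^s$.) A morphism $f\in\mathrm{Hom}_{\mathcal C}(X,Y)$ is a homomorphism $\mathsf X\to\mathsf Y$ if for all relation symbols $R$ of arity $r$ and all $\eta\in\mathrm{Hom}_{\mathcal C}(r,X)$ one has $\eta\in R^{\mathsf X}\iff f\circ\eta\in R^{\mathsf Y}$, and for all function symbols $F$ of arity $(r,s)$ and all $\gamma\in\mathrm{Hom}_{\mathcal C}(Y,r)$ one has $F^{\mathsf X}(\gamma\circ f)=F^{\mathsf Y}(\gamma)\circ f$. For a $\mathbf{Fin}^{\mathrm{op}}$-language $\mathcal L$, let $(\mathcal L,(\mathbf{Fin},\le^*)^{\mathrm{op}})$ be the category whose objects $\mathsf K$ are the finite linear orders $K$ together with an $\mathcal L$-structure on $G(K)$, and whose morphisms $\mathsf K\to\mathsf M$ are the homomorphisms of the form $G(i)$ with $i\in\mathrm{Hom}_{(\mathbf{Fin},\le^*)^{\mathrm{op}}}(K,M)$, that is, with $i$ a rigid surjection from $M$ onto $K$. Then, for every $\mathbf{Fin}^{\mathrm{op}}$-language $\mathcal L$, the category $\mathcal E=(\mathcal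 L,(\mathbf{Fin},\le^*)^{\mathrm{op}})$ has the Ramsey property: for all objects $A,B$ of $\mathcal E$ and every integer $r>0$ there is an object $Z$ of $\mathcal E$ such that for every colouring $\chi\colon\mathrm{Hom}_{\mathcal E}(A,Z)\to\{0,\dots,r-1\}$ there is $f\in\mathrm{Hom}_{\mathcal E}(B,Z)$ such that $\chi$ is constant on the (possibly empty) set $f\circ\mathrm{Hom}_{\mathcal E}(A,B)$. -/

import Mathlib

open CategoryTheory Opposite

universe u v w v₁ u₁ v₂ u₂

/-- A `C`-language, for a category `C`: function symbols, whose arities are pairs of objects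
of `C`, and relation symbols, whose arities are objects of `C`. -/
structure CatLanguage (C : Type u₁) [Category.{v₁} C] where
  /-- the function symbols -/
  Func : Type v
  /-- the relation symbols -/
  Rel : Type w
  /-- the arities of the function symbols -/
  funcArity : Func → C × C
  /-- the arities of the relation symbols -/
  relArity : Rel → C

namespace CatLanguage

section

variable {C : Type u₁} [Category.{v₁} C]

/-- An `L`-structure with underlying object `X`: a relation symbol of arity `r` is interpreted as
a set of morphisms `r ⟶ X`, and a function symbol of arity `(r, s)` as a function from the
morphisms `X ⟶ r` to the morphisms `X ⟶ s`. -/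
structure StructureOn (L : CatLanguage.{v, w} C) (X : C) where
  /-- the interpretation of the relation symbols -/
  rel : ∀ R : L.Rel, Set (L.relArity R ⟶ X)
  /-- the interpretation of the function symbols -/
  func : ∀ F : L.Func, (X ⟶ (L.funcArity F).1) → (X ⟶ (L.funcArity F).2)

/-- `f : X ⟶ Y` is an `L`-homomorphism from the structure `A` on `X` to the structure `B` on `Y`.
Relations are both preserved and reflected. -/
structure IsHom {L : CatLanguage.{v, w} C} {X Y : C} (A : L.StructureOn X) (B : L.StructureOn Y)
    (f : X ⟶ Y) : Prop where
  rel_iff : ∀ (R : L.Rel) (η : L.relArity R ⟶ X), η ∈ A.rel R ↔ η ≫ f ∈ B.rel R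
  func_eq : ∀ (F : L.Func) (γ : Y ⟶ (L.funcArity F).1), A.func F (f ≫ γ) = f ≫ B.func F γ

theorem IsHom.id {L : CatLanguage.{v, w} C} {X : C} (A : L.StructureOn X) : IsHom A A (𝟙 X) :=
  ⟨fun _ _ => by simp, fun _ _ => by simp⟩

theorem IsHom.comp {L : CatLanguage.{v, w} C} {X Y Z : C} {A : L.StructureOn X}
    {B : L.StructureOn Y} {E : L.StructureOn Z} {f : X ⟶ Y} {g : Y ⟶ Z}
    (hf : IsHom A B f) (hg : IsHom B E g) : IsHom A E (f ≫ g) :=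
  ⟨fun R η => by rw [hf.rel_iff, hg.rel_iff, Category.assoc],
    fun F γ => by rw [Category.assoc, hf.func_eq, hg.func_eq, Category.assoc]⟩

variable {D : Type u₂} [Category.{v₂} D]

/-- The objects of the category `(L, D)` attached to a functor `G : D ⥤ C` and a `C`-language `L`:
an object `K` of `D` together with an `L`-structure on `G K`. -/
structure StrCat (L : CatLanguage.{v, w} C) (G : D ⥤ C) where
  /-- the object of `D` -/
  base : D
  /-- the structure on its image under `G` -/
  str : L.StructureOn (G.obj base)

/-- The morphisms of `(L, D)` are the morphisms of the form `G i`, for `i` a morphism of `D`, that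
are `L`-homomorphisms. -/
instance (L : CatLanguage.{v, w} C) (G : D ⥤ C) : Category (StrCat L G) where
  Hom K M := {f : G.obj K.base ⟶ G.obj M.base //
    (∃ i : K.base ⟶ M.base, G.map i = f) ∧ IsHom K.str M.str f}
  id K := ⟨𝟙 _, ⟨𝟙 _, G.map_id _⟩, IsHom.id _⟩
  comp f g := ⟨f.1 ≫ g.1,
    by
      obtain ⟨i, hi⟩ := f.2.1
      obtain ⟨j, hj⟩ := g.2.1
      exact ⟨i ≫ j, by rw [G.map_comp, hi, hj]⟩,
    f.2.2.comp g.2.2⟩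
  id_comp f := Subtype.ext (Category.id_comp f.1)
  comp_id f := Subtype.ext (Category.comp_id f.1)
  assoc f g h := Subtype.ext (Category.assoc f.1 g.1 h.1)

end

end CatLanguage

/-- `T` is monochromatic for the colouring `χ`: all its elements have one and the same colour. The
empty set is monochromatic as soon as there is a colour. -/
def IsMonochromatic {S : Type u} {r : ℕ} (χ : S → Fin r) (T : Set S) : Prop :=
  ∃ c : Fin r, ∀ x ∈ T, χ x = c

/-- `Z` is a Ramsey witness for `A` and `B` with `r` colours, `Z → (B)^A_r`: for every
`r`-colouring of `Hom(A, Z)` there is `f : B ⟶ Z` such that `f ∘ Hom(A, B)` is monochromatic. -/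
def IsRamseyWitness {C : Type u₁} [Category.{v₁} C] (Z B A : C) (r : ℕ) : Prop :=
  ∀ χ : (A ⟶ Z) → Fin r, ∃ f : B ⟶ Z,
    IsMonochromatic χ (Set.range fun g : A ⟶ B => g ≫ f)

/-- The Ramsey property of a category. -/
def HasRamseyProperty (C : Type u₁) [Category.{v₁} C] : Prop :=
  ∀ (A B : C) (r : ℕ), 0 < r → ∃ Z : C, IsRamseyWitness Z B A r

/-- A rigid surjection between linear orders: a surjection such that the image of every initial
segment is an initial segment. -/
def IsRigidSurjection {X Y : Type*} [LinearOrder X] [LinearOrder Y] (f : X → Y) : Prop :=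
  Function.Surjective f ∧ ∀ I : Set X, IsLowerSet I → IsLowerSet (f '' I)

theorem IsRigidSurjection.id (X : Type*) [LinearOrder X] :
    IsRigidSurjection (fun x : X => x) :=
  ⟨Function.surjective_id, fun I hI => by rwa [Set.image_id']⟩

theorem IsRigidSurjection.comp {X Y Z : Type*} [LinearOrder X] [LinearOrder Y] [LinearOrder Z]
    {f : X → Y} {g : Y → Z} (hg : IsRigidSurjection g) (hf : IsRigidSurjection f) :
    IsRigidSurjection (fun x => g (f x)) :=
  ⟨hg.1.comp hf.1, fun I hI => by
    have h := hg.2 _ (hf.2 I hI)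
    rwa [Set.image_image] at h⟩

/-- The objects of `(Fin, ≤*)`: finite linear orders. -/
structure FinLinOrdRigid where
  /-- the underlying set -/
  carrier : Type u
  [linearOrder : LinearOrder carrier]
  [finite : Finite carrier]

attribute [instance] FinLinOrdRigid.linearOrder FinLinOrdRigid.finite

namespace FinLinOrdRigid

/-- The category `(Fin, ≤*)` of finite linear orders and rigid surjections. -/
instance : Category FinLinOrdRigid.{u} where
  Hom X Y := {f : X.carrier → Y.carrier // IsRigidSurjection f}
  id X := ⟨fun x => x, IsRigidSurjection.id _⟩
  comp f g := ⟨fun x => g.1 (f.1 x), g.2.comp f.2⟩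

/-- The functor that forgets the order. -/
def forgetOrder : FinLinOrdRigid.{u} ⥤ FintypeCat.{u} where
  obj X := FintypeCat.of X.carrier
  map f := FintypeCat.homMk f.1

end FinLinOrdRigid

/-- The functor `G : (Fin, ≤*)ᵒᵖ ⥤ Finᵒᵖ` with `G (K, ≤) = K` and `G f = f`. -/
def dualForgetOrder : FinLinOrdRigid.{u}ᵒᵖ ⥤ FintypeCat.{u}ᵒᵖ :=
  FinLinOrdRigid.forgetOrder.op

/-- `RigidWord p w q`: the letters of `w` are natural numbers less than `q`, and the letters from
`p` to `q - 1` all occur in `w`, their first occurrences being in increasing order. -/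
inductive RigidWord : ℕ → List ℕ → ℕ → Prop
  | nil (p : ℕ) : RigidWord p [] p
  | old {p x q : ℕ} {w : List ℕ} : x < p → RigidWord p w q → RigidWord p (x :: w) q
  | new {p q : ℕ} {w : List ℕ} : RigidWord (p + 1) w q → RigidWord p (p :: w) q

/-- Replace every letter `x` of a word by the `x`-th entry of `t`. -/
def substWord (t f : List ℕ) : List ℕ := f.map fun x => t.getD x 0

/-- Raise all letters from `p` on by one. -/
def shiftWord (p : ℕ) (f : List ℕ) : List ℕ := f.map fun x => if x < p then x else x + 1

@[simp] theorem length_substWord (t f : List ℕ) : (substWord t f).length = f.length := by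
  simp [substWord]

@[simp] theorem length_shiftWord (p : ℕ) (f : List ℕ) : (shiftWord p f).length = f.length := by
  simp [shiftWord]

@[simp] theorem substWord_nil (t : List ℕ) : substWord t [] = [] := rfl

@[simp] theorem substWord_cons (t f : List ℕ) (x : ℕ) :
    substWord t (x :: f) = t.getD x 0 :: substWord t f := rfl

@[simp] theorem substWord_append (t f g : List ℕ) :
    substWord t (f ++ g) = substWord t f ++ substWord t g := by
  simp [substWord]

theorem substWord_congr {t t' f : List ℕ} (h : ∀ x ∈ f, t.getD x 0 = t'.getD x 0) :
    substWord t f = substWord t' f :=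
  List.map_congr_left h

theorem substWord_append_of_lt {t g f : List ℕ} (h : ∀ x ∈ f, x < t.length) :
    substWord (t ++ g) f = substWord t f :=
  substWord_congr fun x hx => by rw [List.getD_append _ _ _ _ (h x hx)]

theorem substWord_range {p : ℕ} {f : List ℕ} (h : ∀ x ∈ f, x < p) :
    substWord (List.range p) f = f := by
  unfold substWord
  conv_rhs => rw [← List.map_id f]
  refine List.map_congr_left fun x hx => ?_
  rw [List.getD_eq_getElem _ _ (by simpa using h x hx)]
  simp

theorem substWord_self_range (t g : List ℕ) : substWord (t ++ g) (List.range t.length) = t := by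
  apply List.ext_getElem
  · simp
  · intro i h1 h2
    simp [substWord, List.getElem?_append_left h2, h2]

theorem substWord_substWord {t t' f : List ℕ} (h : ∀ x ∈ f, x < t'.length) :
    substWord t (substWord t' f) = substWord (substWord t t') f := by
  unfold substWord
  rw [List.map_map]
  refine List.map_congr_left fun x hx => ?_
  have := h x hx
  simp [this]

theorem substWord_shiftWord (t g f : List ℕ) (a : ℕ) :
    substWord (t ++ a :: g) (shiftWord t.length f) = substWord (t ++ g) f := by
  unfold substWord shiftWord
  rw [List.map_map]
  refine List.map_congr_left fun x _ => ?_
  by_cases hx : x < t.length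
  · simp only [Function.comp, hx, if_true]
    rw [List.getD_append _ _ _ _ hx, List.getD_append _ _ _ _ hx]
  · push Not at hx
    simp only [Function.comp, hx.not_gt, if_false]
    rw [List.getD_append_right _ _ _ _ hx, List.getD_append_right _ _ _ _ (by omega),
      show x + 1 - t.length = (x - t.length) + 1 by omega, List.getD_cons_succ]

namespace RigidWord

theorem le {p q : ℕ} {w : List ℕ} (h : RigidWord p w q) : p ≤ q := by
  induction h with
  | nil => exact le_rfl
  | old _ _ ih => exact ih
  | new _ ih => omega

theorem lt {p q : ℕ} {w : List ℕ} (h : RigidWord p w q) : ∀ x ∈ w, x < q := by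
  induction h with
  | nil => simp
  | old h1 h2 ih =>
    have := h2.le
    simpa using ⟨by omega, ih⟩
  | new h2 ih =>
    have := h2.le
    simpa using ⟨by omega, ih⟩

theorem of_lt {p : ℕ} {w : List ℕ} (h : ∀ x ∈ w, x < p) : RigidWord p w p := by
  induction w with
  | nil => exact .nil p
  | cons x w ih =>
    simp only [List.mem_cons, forall_eq_or_imp] at h
    exact .old h.1 (ih h.2)

theorem append {p q s : ℕ} {w w' : List ℕ} (h : RigidWord p w q) (h' : RigidWord q w' s) :
    RigidWord p (w ++ w') s := by
  induction h with
  | nil => exact h'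
  | old h1 _ ih => exact .old h1 (ih h')
  | new _ ih => exact .new (ih h')

theorem shift {p q s : ℕ} {w : List ℕ} (h : RigidWord q w s) (hp : p ≤ q) :
    RigidWord (q + 1) (shiftWord p w) (s + 1) := by
  induction h with
  | nil => exact .nil _
  | old h1 _ ih => exact .old (by dsimp only; split_ifs <;> omega) (ih hp)
  | new _ ih =>
    have := RigidWord.new (ih (by omega))
    simpa [shiftWord, hp.not_gt] using this

/-- Substitution of rigid words: `t` gives the values of the old letters, `g` those of the new
ones. -/
theorem subst {p q : ℕ} {f : List ℕ} (hf : RigidWord p f q) :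
    ∀ {t g : List ℕ} {p' s : ℕ}, t.length = p → (∀ x ∈ t, x < p') → p + g.length = q →
      RigidWord p' g s → RigidWord p' (substWord (t ++ g) f) s := by
  induction hf with
  | nil p =>
    intro t g p' s _ _ hg h
    have : g = [] := List.length_eq_zero_iff.1 (by omega)
    subst this
    simpa using h
  | @old p x q w hx h ih =>
    intro t g p' s ht ht' hg h
    rw [substWord_cons, List.getD_append _ _ _ _ (by omega)]
    refine .old (ht' _ ?_) (ih ht ht' hg h)
    rw [List.getD_eq_getElem _ _ (by omega)]
    exact List.getElem_mem _
  | @new p q w hw ih =>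
    intro t g p' s ht ht' hg h
    have := hw.le
    cases h with
    | nil => simp at hg; omega
    | @old _ b _ g hb h =>
      simp only [List.length_cons] at hg
      rw [substWord_cons, List.getD_append_right _ _ _ _ (by omega), List.append_cons]
      refine .old (by simpa [ht] using hb) (ih (by simp [ht]) ?_ (by omega) h)
      simp only [List.mem_append, List.mem_singleton]
      rintro x (hx | rfl)
      exacts [ht' x hx, hb]
    | @new _ _ g h =>
      simp only [List.length_cons] at hg
      rw [substWord_cons, List.getD_append_right _ _ _ _ (by omega), List.append_cons]
      simp only [ht, Nat.sub_self, List.getD_cons_zero]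
      refine .new (ih (by simp [ht]) ?_ (by omega) h)
      simp only [List.mem_append, List.mem_singleton]
      rintro x (hx | rfl)
      exacts [(ht' x hx).trans (by omega), by omega]

theorem comp {p q s : ℕ} {f g : List ℕ} (hf : RigidWord p f q) (hg : RigidWord p g s)
    (h : p + g.length = q) : RigidWord p (substWord (List.range p ++ g) f) s :=
  hf.subst (by simp) (by simp) h hg

theorem split {p q y : ℕ} {w : List ℕ} (h : RigidWord p w q) (hp : p ≤ y) (hq : y < q) :
    ∃ w₁ w₂, w = w₁ ++ y :: w₂ ∧ RigidWord p w₁ y ∧ RigidWord (y + 1) w₂ q := by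
  induction h with
  | nil => omega
  | @old p x q w hx h ih =>
    obtain ⟨w₁, w₂, rfl, h1, h2⟩ := ih hp hq
    exact ⟨x :: w₁, w₂, rfl, .old hx h1, h2⟩
  | @new p q w h ih =>
    rcases hp.eq_or_lt with rfl | hp
    · exact ⟨[], w, rfl, .nil _, h⟩
    · obtain ⟨w₁, w₂, rfl, h1, h2⟩ := ih hp hq
      exact ⟨p :: w₁, w₂, rfl, .new h1, h2⟩

theorem mem {p q y : ℕ} {w : List ℕ} (h : RigidWord p w q) (hp : p ≤ y) (hq : y < q) : y ∈ w := by
  obtain ⟨w₁, w₂, rfl, -, -⟩ := h.split hp hq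
  simp

theorem exists_getElem_eq {p q : ℕ} {w : List ℕ} (h : RigidWord p w q) :
    ∀ (i : ℕ) (hi : i < w.length) (y : ℕ), p ≤ y → y < w[i] →
      ∃ (j : ℕ) (hj : j < i), w[j] = y := by
  induction h with
  | nil => intro i hi; simp at hi
  | @old p x q w hx h ih =>
    intro i hi y hp hy
    cases i with
    | zero => simp at hy; omega
    | succ i =>
      obtain ⟨j, hj, e⟩ := ih i (by simpa using hi) y hp (by simpa using hy)
      exact ⟨j + 1, by omega, by simpa using e⟩
  | @new p q w h ih =>
    intro i hi y hp hy
    cases i with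
    | zero => simp at hy; omega
    | succ i =>
      rcases hp.eq_or_lt with rfl | hp
      · exact ⟨0, by omega, rfl⟩
      obtain ⟨j, hj, e⟩ := ih i (by simpa using hi) y hp (by simpa using hy)
      exact ⟨j + 1, by omega, by simpa using e⟩

theorem of_exists {w : List ℕ} {q : ℕ} : ∀ {p : ℕ}, p ≤ q → (∀ x ∈ w, x < q) →
    (∀ y, p ≤ y → y < q → y ∈ w) →
    (∀ (i : ℕ) (hi : i < w.length) (y : ℕ), p ≤ y → y < w[i] →
      ∃ (j : ℕ) (hj : j < i), w[j] = y) → RigidWord p w q := by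
  induction w with
  | nil =>
    intro p hpq _ h _
    rcases hpq.eq_or_lt with rfl | hpq
    · exact .nil _
    · simpa using h p le_rfl hpq
  | cons x w ih =>
    intro p hpq hlt hmem hfirst
    simp only [List.mem_cons, forall_eq_or_imp] at hlt
    rcases lt_trichotomy x p with hx | rfl | hx
    · refine .old hx (ih hpq hlt.2 ?_ ?_)
      · intro y h1 h2
        rcases List.mem_cons.1 (hmem y h1 h2) with rfl | h
        · omega
        · exact h
      · intro i hi y h1 h2
        obtain ⟨j, hj, e⟩ := hfirst (i + 1) (by simpa using hi) y h1 (by simpa using h2)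
        cases j with
        | zero => simp at e; omega
        | succ j => exact ⟨j, by omega, by simpa using e⟩
    · refine .new (ih hlt.1 hlt.2 ?_ ?_)
      · intro y h1 h2
        rcases List.mem_cons.1 (hmem y (by omega) h2) with rfl | h
        · omega
        · exact h
      · intro i hi y h1 h2
        obtain ⟨j, hj, e⟩ := hfirst (i + 1) (by simpa using hi) y (by omega) (by simpa using h2)
        cases j with
        | zero => simp at e; omega
        | succ j => exact ⟨j, by omega, by simpa using e⟩
    · obtain ⟨j, hj, _⟩ := hfirst 0 (by simp) p le_rfl (by simpa using hx)
      omega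

end RigidWord

/-- The Hales-Jewett theorem for words of natural numbers. -/
theorem exists_word_line (p : ℕ) (κ : Type v) [Finite κ] :
    ∃ d : ℕ, ∀ C : List ℕ → κ, ∃ f : List ℕ, f.length = d ∧ RigidWord p f (p + 1) ∧
      ∀ a b, a < p → b < p →
        C (substWord (List.range p ++ [a]) f) = C (substWord (List.range p ++ [b]) f) := by
  obtain ⟨ι, _, hι⟩ := Combinatorics.Line.exists_mono_in_high_dimension (Fin p) κ
  let e := Fintype.equivFin ι
  refine ⟨Fintype.card ι, fun C => ?_⟩
  obtain ⟨l, c, hl⟩ := hι fun x => C (List.ofFn fun i => (x (e.symm i) : ℕ))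
  let f : List ℕ := List.ofFn fun i => match l.idxFun (e.symm i) with
    | none => p
    | some a => (a : ℕ)
  have key : ∀ a : Fin p, C (substWord (List.range p ++ [(a : ℕ)]) f) = c := by
    intro a
    rw [← hl a]
    congr 1
    simp only [substWord, f, List.map_ofFn]
    congr 1
    funext i
    simp only [Function.comp]
    cases h : l.idxFun (e.symm i) with
    | none => simp [h]
    | some b => simp [h]
  have hle : ∀ x ∈ f, x < p + 1 := by
    intro x hx
    obtain ⟨i, rfl⟩ := (List.mem_ofFn' _ _).1 hx
    dsimp only
    split <;> omega
  refine ⟨f, by simp [f], .of_exists (by omega) hle ?_ ?_, fun a b ha hb => ?_⟩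
  · intro y h1 h2
    obtain rfl : y = p := by omega
    obtain ⟨i, hi⟩ := l.proper
    refine (List.mem_ofFn' _ _).2 ⟨e i, ?_⟩
    simp [hi]
  · intro i hi y h1 h2
    have := hle _ (List.getElem_mem hi)
    omega
  · exact (key ⟨a, ha⟩).trans (key ⟨b, hb⟩).symm

/-- A rigid word with letters to be substituted such that the colours of the prefixes ending
before the first occurrence of a new letter do not depend on the substitution. -/
theorem exists_word_prefixes {p : ℕ} (hp : 0 < p) (κ : Type v) [Finite κ] (m : ℕ) :
    ∃ M : ℕ, ∀ C : List ℕ → κ, ∃ f : List ℕ, f.length = M ∧ RigidWord p f (p + m) ∧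
      (∀ j < m, ∃ f₁ f₂, f = f₁ ++ (p + j) :: f₂ ∧ RigidWord p f₁ (p + j) ∧
        RigidWord (p + j + 1) f₂ (p + m) ∧ ∃ c, ∀ a : List ℕ, a.length = j → RigidWord p a p →
          C (substWord (List.range p ++ a) f₁) = c) ∧
      ∃ c, ∀ a : List ℕ, a.length = m → RigidWord p a p →
          C (substWord (List.range p ++ a) f) = c := by
  induction m with
  | zero =>
    exact ⟨0, fun C => ⟨[], rfl, .nil _, by simp, C [], by simp⟩⟩
  | succ m ih =>
    obtain ⟨M, hM⟩ := ih
    have : Finite {l : List (Fin p) // l.length ≤ M} := (List.finite_length_le (Fin p) M).to_subtype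
    obtain ⟨d, hd⟩ := exists_word_line p ({l : List (Fin p) // l.length ≤ M} → κ)
    refine ⟨d + M, fun C => ?_⟩
    obtain ⟨l, hl, hlr, hlc⟩ := hd fun x w => C (x ++ w.1.map Fin.val)
    obtain ⟨f, hf, hfr, hfs, c, hfc⟩ := hM fun w => C (substWord (List.range p ++ [0]) l ++ w)
    have hlC : ∀ a w, a < p → RigidWord p w p → w.length ≤ M →
        C (substWord (List.range p ++ [a]) l ++ w) =
          C (substWord (List.range p ++ [0]) l ++ w) := by
      intro a w ha hw hwM
      have := congrFun (hlc a 0 ha hp)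
        ⟨w.attach.map fun x => ⟨x.1, hw.lt _ x.2⟩, by simpa using hwM⟩
      simpa [List.map_map, Function.comp_def] using this
    have hll : ∀ x ∈ l, x < p + 1 := hlr.lt
    have hcomp : ∀ a a' g, substWord (List.range p ++ a :: a') (l ++ shiftWord p g) =
        substWord (List.range p ++ [a]) l ++ substWord (List.range p ++ a') g := by
      intro a a' g
      rw [substWord_append]
      congr 1
      · rw [List.append_cons]
        exact substWord_append_of_lt (by simpa using hll)
      · simpa using substWord_shiftWord (List.range p) a' g a
    refine ⟨l ++ shiftWord p f, by simp [hl, hf], ?_, ?_, c, ?_⟩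
    · have := hlr.append (hfr.shift le_rfl)
      rwa [add_assoc] at this
    · intro j hj
      cases j with
      | zero =>
        obtain ⟨u, v, rfl, h1, h2⟩ := hlr.split le_rfl (Nat.lt_succ_self p)
        refine ⟨u, v ++ shiftWord p f, by simp, h1, ?_, C u, ?_⟩
        · have := h2.append (hfr.shift le_rfl)
          rwa [add_assoc] at this
        · intro a ha _
          obtain rfl := List.length_eq_zero_iff.1 ha
          rw [List.append_nil, substWord_range h1.lt]
      | succ j =>
        obtain ⟨f₁, f₂, rfl, h1, h2, c, hc⟩ := hfs j (by omega)
        refine ⟨l ++ shiftWord p f₁, shiftWord p f₂, ?_, ?_, ?_, c, ?_⟩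
        · simp [shiftWord, add_assoc]
        · have := hlr.append (h1.shift le_rfl)
          rwa [add_assoc] at this
        · have := h2.shift (show p ≤ p + j + 1 by omega)
          rwa [add_assoc p m, add_assoc p j] at this
        · intro a ha har
          cases har with
          | nil => simp at ha
          | new h => have := h.le; omega
          | @old _ a0 _ a h0 har =>
            simp only [List.length_cons, Nat.add_right_cancel_iff] at ha
            rw [hcomp, hlC a0 _ h0, hc a ha har]
            · exact h1.comp har (by omega)
            · simp at hf ⊢; omega
    · intro a ha har
      cases har with
      | nil => simp at ha
      | new h => have := h.le; omega
      | @old _ a0 _ a h0 har =>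
        simp only [List.length_cons, Nat.add_right_cancel_iff] at ha
        rw [hcomp, hlC a0 _ h0, hfc a ha har]
        · exact hfr.comp har (by omega)
        · simp [hf]

/-- A rigid word all of whose first occurrences are at positions with a given property. -/
theorem exists_word_select {p : ℕ} (hp : 0 < p) (P : ℕ → Prop) [DecidablePred P] (M : ℕ) :
    ∀ m ≤ Nat.count P M, ∃ f : List ℕ, f.length = M ∧ RigidWord p f (p + m) ∧
      ∀ j < m, ∃ f₁ f₂, f = f₁ ++ (p + j) :: f₂ ∧ RigidWord p f₁ (p + j) ∧
        RigidWord (p + j + 1) f₂ (p + m) ∧ P f₁.length := by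
  induction M with
  | zero =>
    intro m hm
    obtain rfl : m = 0 := by simpa using hm
    exact ⟨[], rfl, .nil _, by simp⟩
  | succ M ih =>
    intro m hm
    by_cases h : m ≤ Nat.count P M
    · obtain ⟨f, hf, hfr, hfs⟩ := ih m h
      have h0 : RigidWord (p + m) [0] (p + m) := .of_lt (by simp; omega)
      refine ⟨f ++ [0], by simp [hf], hfr.append h0, fun j hj => ?_⟩
      obtain ⟨f₁, f₂, rfl, h1, h2, h3⟩ := hfs j hj
      exact ⟨f₁, f₂ ++ [0], by simp, h1, h2.append h0, h3⟩
    · rw [Nat.count_succ] at hm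
      have hP : P M := by
        by_contra hP
        simp [hP] at hm
        omega
      simp only [hP, if_true] at hm
      obtain ⟨m, rfl⟩ : ∃ k, m = k + 1 := ⟨m - 1, by omega⟩
      obtain ⟨f, hf, hfr, hfs⟩ := ih m (by omega)
      have h0 : RigidWord (p + m) [p + m] (p + m + 1) := .new (.nil _)
      refine ⟨f ++ [p + m], by simp [hf], hfr.append h0, fun j hj => ?_⟩
      rcases (Nat.lt_succ_iff.1 hj).eq_or_lt with rfl | hj
      · exact ⟨f, [], rfl, hfr, .nil _, by rwa [hf]⟩
      · obtain ⟨f₁, f₂, rfl, h1, h2, h3⟩ := hfs j hj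
        exact ⟨f₁, f₂ ++ [p + m], by simp, h1, h2.append h0, h3⟩

theorem exists_le_count_eq (κ : Type v) [Finite κ] (m : ℕ) :
    ∃ M : ℕ, ∀ e : ℕ → κ, ∃ c, ∃ _ : DecidablePred fun j => e j = c,
      m ≤ Nat.count (fun j => e j = c) M := by
  classical
  have := Fintype.ofFinite κ
  rcases isEmpty_or_nonempty κ with h | h
  · exact ⟨0, fun e => (h.false (e 0)).elim⟩
  refine ⟨Fintype.card κ * m, fun e => ?_⟩
  obtain ⟨c, -, hc⟩ := Finset.exists_le_card_fiber_of_mul_le_card_of_maps_to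
    (s := Finset.range (Fintype.card κ * m)) (t := Finset.univ) (f := e) (n := m)
    (by simp) Finset.univ_nonempty (by simp)
  exact ⟨c, fun _ => inferInstance, by rwa [Nat.count_eq_card_filter_range]⟩

/-- As `exists_word_prefixes`, with one colour for all prefixes. -/
theorem exists_word_prefixes_mono {p : ℕ} (hp : 0 < p) (κ : Type v) [Finite κ] (m : ℕ) :
    ∃ M : ℕ, ∀ C : List ℕ → κ, ∃ f : List ℕ, f.length = M ∧ RigidWord p f (p + m) ∧
      ∃ c, ∀ j < m, ∃ f₁ f₂, f = f₁ ++ (p + j) :: f₂ ∧ RigidWord p f₁ (p + j) ∧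
        RigidWord (p + j + 1) f₂ (p + m) ∧ ∀ a : List ℕ, a.length = j → RigidWord p a p →
          C (substWord (List.range p ++ a) f₁) = c := by
  obtain ⟨M₀, hM₀⟩ := exists_le_count_eq κ m
  obtain ⟨M, hM⟩ := exists_word_prefixes hp κ M₀
  refine ⟨M, fun C => ?_⟩
  obtain ⟨f, hf, hfr, hfs, -⟩ := hM C
  have : Nonempty κ := ⟨C []⟩
  choose! F₁ F₂ hF hF₁ hF₂ e he using hfs
  obtain ⟨c, _, hc⟩ := hM₀ e
  obtain ⟨s, hs, hsr, hss⟩ := exists_word_select hp _ M₀ m hc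
  refine ⟨substWord (List.range p ++ s) f, by simp [hf], hfr.comp hsr (by omega), c, ?_⟩
  intro j hj
  obtain ⟨s₁, s₂, rfl, h1, h2, h3⟩ := hss j hj
  have hlen : s₁.length < M₀ := by simp at hs; omega
  have hF₁lt := (hF₁ _ hlen).lt
  have e1 : substWord (List.range p ++ (s₁ ++ (p + j) :: s₂)) (F₁ s₁.length) =
      substWord (List.range p ++ s₁) (F₁ s₁.length) := by
    rw [← List.append_assoc]
    exact substWord_append_of_lt (by simpa using hF₁lt)
  refine ⟨substWord (List.range p ++ s₁) (F₁ s₁.length),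
    substWord ((List.range p ++ s₁ ++ [p + j]) ++ s₂) (F₂ s₁.length), ?_, ?_, ?_, ?_⟩
  · conv_lhs => rw [hF _ hlen]
    rw [substWord_append, e1, substWord_cons]
    congr 2
    · rw [← List.append_assoc, List.getD_append_right _ _ _ _ (by simp)]
      simp
    · simp
  · exact (hF₁ _ hlen).comp h1 rfl
  · refine (hF₂ _ hlen).subst (by simp; omega) ?_ (by simp at hs; omega) h2
    intro x hx
    simp only [List.mem_append, List.mem_range, List.mem_singleton] at hx
    rcases hx with (hx | hx) | hx
    · omega
    · have := h1.lt x hx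
      omega
    · omega
  · intro a ha har
    rw [substWord_substWord (by simpa using hF₁lt), substWord_append,
      show substWord (List.range p ++ a) (List.range p) = List.range p by
        simpa using substWord_self_range (List.range p) a, ← h3]
    exact he _ hlen _ (by simp) (h1.comp har (by omega))

/-- The Graham-Rothschild property for rigid words with `p` old and `k` new letters. -/
def WordRamsey (p k : ℕ) : Prop :=
  ∀ (κ : Type v) [Finite κ] (m : ℕ), ∃ n : ℕ, ∀ C : List ℕ → κ, ∃ f : List ℕ, f.length = n ∧
    RigidWord p f (p + m) ∧ ∃ c, ∀ g : List ℕ, g.length = m → RigidWord p g (p + k) →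
      C (substWord (List.range p ++ g) f) = c

theorem wordRamsey_zero {p : ℕ} (hp : 0 < p) : WordRamsey.{v} p 0 := by
  intro κ _ m
  obtain ⟨M, hM⟩ := exists_word_prefixes hp κ m
  refine ⟨M, fun C => ?_⟩
  obtain ⟨f, hf, hfr, -, c, hc⟩ := hM C
  exact ⟨f, hf, hfr, c, hc⟩

theorem exists_word_prefix_colouring {p k : ℕ} (H : WordRamsey.{v} (p + 1) k) (M : ℕ) :
    ∀ (κ : Type v) [Finite κ], ∃ n : ℕ, ∀ C : List ℕ → κ, ∃ f : List ℕ, f.length = n ∧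
      RigidWord p f (p + M) ∧ ∃ c : List ℕ → κ, ∀ a h : List ℕ, RigidWord p a p →
        RigidWord (p + 1) h (p + 1 + k) → a.length + 1 + h.length = M →
          C (substWord (List.range p ++ (a ++ p :: h)) f) = c a := by
  induction M with
  | zero => exact fun κ _ => ⟨0, fun C => ⟨[], rfl, .nil _, fun _ => C [], by simp⟩⟩
  | succ M ih =>
    intro κ _
    obtain ⟨n₁, h₁⟩ := ih (Fin p → κ)
    obtain ⟨n₂, h₂⟩ := H κ n₁
    refine ⟨n₂ + 1, fun C => ?_⟩
    obtain ⟨f, hf, hfr, c, hc⟩ := h₂ fun w => C (p :: w)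
    obtain ⟨f', hf', hfr', c', hc'⟩ :=
      h₁ fun w (a : Fin p) => C (a :: substWord (List.range p ++ (a : ℕ) :: w) f)
    have hfr'' := hfr'.shift le_rfl
    have hflt := hfr.lt
    have hcomp : ∀ b g, substWord (List.range p ++ b :: g)
        (substWord (List.range (p + 1) ++ shiftWord p f') f) =
          substWord (List.range p ++ b :: substWord (List.range p ++ g) f') f := by
      intro b g
      rw [substWord_substWord (by simpa [hf'] using hflt), substWord_append]
      congr 1
      have e1 := substWord_shiftWord (List.range p) g f' b
      have e2 := substWord_self_range (List.range p ++ [b]) g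
      simp only [List.length_append, List.length_range, List.length_singleton,
        List.append_assoc, List.singleton_append] at e1 e2
      rw [e1, e2]
      simp
    refine ⟨p :: substWord (List.range (p + 1) ++ shiftWord p f') f, by simp [hf],
      .new ?_, fun a => match a with
        | [] => c
        | b :: a => if hb : b < p then c' a ⟨b, hb⟩ else c, ?_⟩
    · have := hfr.comp hfr'' (by simp [hf'])
      rwa [add_assoc] at this
    · intro a h ha hh hlen
      rw [substWord_cons, List.getD_append_right _ _ _ _ (by simp)]
      cases ha with
      | nil =>
        simp only [List.length_nil] at hlen
        simp only [List.nil_append, List.length_range, Nat.sub_self, List.getD_cons_zero]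
        rw [hcomp, List.append_cons, ← List.range_succ]
        refine hc _ (by simp [hf']) ?_
        have := hfr''.subst (t := List.range (p + 1)) (g := h) (p' := p + 1) (by simp) (by simp)
          (by omega) hh
        rw [List.range_succ, List.append_assoc, List.singleton_append] at this
        have e1 := substWord_shiftWord (List.range p) h f' p
        rw [List.length_range] at e1
        rwa [e1] at this
      | new h => have := h.le; omega
      | @old _ b _ a hb ha =>
        simp only [List.length_cons] at hlen
        have := congrFun (hc' a h ha hh (by omega)) ⟨b, hb⟩
        simpa [hb, hcomp] using this

theorem wordRamsey_succ {p k : ℕ} (hp : 0 < p) (H : WordRamsey.{v} (p + 1) k) :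
    WordRamsey.{v} p (k + 1) := by
  intro κ _ m
  obtain ⟨M, hM⟩ := exists_word_prefixes_mono hp κ m
  obtain ⟨n, hn⟩ := exists_word_prefix_colouring H M κ
  refine ⟨n, fun C => ?_⟩
  obtain ⟨f, hf, hfr, c, hc⟩ := hn C
  obtain ⟨f', hf', hfr', c', hc'⟩ := hM c
  refine ⟨substWord (List.range p ++ f') f, by simp [hf], hfr.comp hfr' (by omega), c', ?_⟩
  intro g hg hgr
  have hflt := hfr.lt
  rw [substWord_substWord (by simpa [hf'] using hflt), substWord_append,
    show substWord (List.range p ++ g) (List.range p) = List.range p by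
      simpa using substWord_self_range (List.range p) g]
  obtain ⟨a, h, rfl, har, hhr⟩ := hgr.split le_rfl (by omega)
  simp only [List.length_append, List.length_cons] at hg
  obtain ⟨f₁, f₂, rfl, h1, h2, h3⟩ := hc' a.length (by omega)
  simp only [List.length_append, List.length_cons] at hf'
  have h1lt := h1.lt
  have hh : RigidWord (p + 1) (substWord ((List.range p ++ a ++ [p]) ++ h) f₂) (p + 1 + k) := by
    refine h2.subst (by simp; omega) ?_ (by omega) (by convert hhr using 1; omega)
    intro x hx
    simp only [List.mem_append, List.mem_range, List.mem_singleton] at hx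
    rcases hx with (hx | hx) | hx
    · omega
    · have := har.lt x hx
      omega
    · omega
  rw [← h3 a rfl har, ← hc _ _ (h1.comp har rfl) hh (by simpa using by omega)]
  congr 3
  rw [substWord_append, substWord_cons]
  congr 1
  · rw [← List.append_assoc]
    exact substWord_append_of_lt (by simpa using h1lt)
  · congr 1
    · rw [← List.append_assoc, List.getD_append_right _ _ _ _ (by simp)]
      simp
    · simp

theorem wordRamsey (k : ℕ) : ∀ {p : ℕ}, 0 < p → WordRamsey.{v} p k := by
  induction k with
  | zero => exact fun hp => wordRamsey_zero hp
  | succ k ih => exact fun hp => wordRamsey_succ hp (ih (Nat.succ_pos _))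

theorem isRigidSurjection_iff {X Y : Type*} [LinearOrder X] [LinearOrder Y] {f : X → Y} :
    IsRigidSurjection f ↔ Function.Surjective f ∧ ∀ x, ∀ y < f x, ∃ x' < x, f x' = y := by
  refine and_congr_right fun _ => ⟨fun h x y hy => ?_, fun h I hI => ?_⟩
  · obtain ⟨x', hx', rfl⟩ := h (Set.Iic x) (isLowerSet_Iic x) hy.le ⟨x, le_rfl, rfl⟩
    exact ⟨x', lt_of_le_of_ne hx' (by rintro rfl; exact hy.false), rfl⟩
  · rintro _ y hy ⟨x, hx, rfl⟩
    rcases hy.eq_or_lt with rfl | hy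
    · exact ⟨x, hx, rfl⟩
    · obtain ⟨x', hx', rfl⟩ := h x y hy
      exact ⟨x', hI hx'.le hx, rfl⟩

/-- The dual Ramsey theorem of Graham and Rothschild. -/
theorem exists_rigidSurjection_mono (A B : Type u) [LinearOrder A] [LinearOrder B] [Finite A]
    [Finite B] [Nonempty A] [Nonempty B] (κ : Type v) [Finite κ] :
    ∃ n : ℕ, ∀ χ : (Fin n → A) → κ, ∃ f : Fin n → B, IsRigidSurjection f ∧
      ∃ c, ∀ h : B → A, IsRigidSurjection h → χ (h ∘ f) = c := by
  have := Fintype.ofFinite A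
  have := Fintype.ofFinite B
  obtain ⟨k, hk⟩ : ∃ k, Fintype.card A = k + 1 := ⟨_, (Nat.succ_pred Fintype.card_ne_zero).symm⟩
  obtain ⟨m, hm⟩ : ∃ m, Fintype.card B = m + 1 := ⟨_, (Nat.succ_pred Fintype.card_ne_zero).symm⟩
  let α := Fintype.orderIsoFinOfCardEq A hk
  let β := Fintype.orderIsoFinOfCardEq B hm
  obtain ⟨n, hn⟩ := wordRamsey k one_pos κ m
  let dA : List ℕ → Fin (n + 1) → A := fun w i => α (Fin.ofNat (k + 1) (w.getD i 0))
  let dB : List ℕ → Fin (n + 1) → B := fun w i => β (Fin.ofNat (m + 1) (w.getD i 0))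
  refine ⟨n + 1, fun χ => ?_⟩
  obtain ⟨f, hf, hfr, c, hc⟩ := hn fun w => χ (dA (0 :: w))
  have hfr0 : RigidWord 0 (0 :: f) (m + 1) := by
    rw [add_comm]
    exact .new hfr
  have hdB : ∀ (i : Fin (n + 1)) (hi : (i : ℕ) < (0 :: f).length),
      ((β.symm (dB (0 :: f) i) : Fin (m + 1)) : ℕ) = (0 :: f)[(i : ℕ)] := by
    intro i hi
    simp only [dB, OrderIso.symm_apply_apply, Fin.val_ofNat]
    rw [List.getD_eq_getElem _ _ hi, Nat.mod_eq_of_lt (hfr0.lt _ (List.getElem_mem _))]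
  have hlen : ∀ i : Fin (n + 1), (i : ℕ) < (0 :: f).length := by
    intro i
    simp only [List.length_cons, hf]
    exact i.2
  refine ⟨dB (0 :: f), isRigidSurjection_iff.2 ⟨?_, ?_⟩, c, ?_⟩
  · intro b
    obtain ⟨i, hi, e⟩ := List.getElem_of_mem (hfr0.mem (Nat.zero_le (β.symm b : ℕ)) (β.symm b).2)
    refine ⟨⟨i, by simpa [hf] using hi⟩, ?_⟩
    apply β.symm.injective
    apply Fin.ext
    rw [hdB _ (by simpa using hi), e]
  · intro i b hb
    have hb' : (β.symm b : ℕ) < (0 :: f)[(i : ℕ)]'(hlen i) := by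
      rw [← hdB i (hlen i)]
      exact β.symm.lt_iff_lt.2 hb
    obtain ⟨j, hj, e⟩ := hfr0.exists_getElem_eq i (hlen i) _ (Nat.zero_le _) hb'
    refine ⟨⟨j, hj.trans i.2⟩, hj, ?_⟩
    apply β.symm.injective
    apply Fin.ext
    rw [hdB _ (hj.trans (hlen i)), e]
  · intro h hh
    rw [isRigidSurjection_iff] at hh
    let H : List ℕ := List.ofFn fun i : Fin (m + 1) => (α.symm (h (β i)) : ℕ)
    have hH : RigidWord 0 H (k + 1) := by
      refine .of_exists (Nat.zero_le _) ?_ ?_ ?_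
      · intro x hx
        obtain ⟨i, rfl⟩ := (List.mem_ofFn' _ _).1 hx
        exact Fin.is_lt _
      · intro y _ hy
        obtain ⟨b, hb⟩ := hh.1 (α ⟨y, hy⟩)
        exact (List.mem_ofFn' _ _).2 ⟨β.symm b, by simp [hb]⟩
      · intro i hi y _ hy
        have hi' : i < m + 1 := by simpa [H] using hi
        simp only [H, List.getElem_ofFn] at hy
        have hy' : y < k + 1 := hy.trans (Fin.is_lt _)
        obtain ⟨b, hb, e⟩ := hh.2 (β ⟨i, hi'⟩) (α ⟨y, hy'⟩) (by
          rw [← α.symm.lt_iff_lt, OrderIso.symm_apply_apply]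
          exact hy)
        refine ⟨β.symm b, ?_, by simp only [H, List.getElem_ofFn]; simp [e]⟩
        rw [← β.symm.lt_iff_lt, OrderIso.symm_apply_apply] at hb
        exact hb
    have hHlen : H.length = m + 1 := by simp [H]
    have hval : ∀ i : Fin (m + 1), H.getD i 0 = α.symm (h (β i)) := by
      intro i
      rw [List.getD_eq_getElem _ _ (by rw [hHlen]; exact i.2)]
      simp only [H, List.getElem_ofFn]
    clear_value H
    cases hH with
    | old h => omega
    | @new _ _ g hg =>
      rw [← hc g (by simpa using hHlen) (by rwa [add_comm 1 k])]
      congr 1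
      funext i
      simp only [Function.comp, dA, dB]
      have e : (0 :: substWord (List.range 1 ++ g) f).getD i 0 =
          (0 :: g).getD ((0 :: f).getD i 0) 0 := by
        change (substWord (0 :: g) (0 :: f)).getD i 0 = _
        rw [List.getD_eq_getElem _ _ (by simpa using hlen i),
          List.getD_eq_getElem (0 :: f) _ (hlen i)]
        exact List.getElem_map _
      rw [e]
      have := hval (Fin.ofNat (m + 1) ((0 :: f).getD i 0))
      rw [Fin.val_ofNat, Nat.mod_eq_of_lt] at this
      · rw [this]
        simp
      · rw [List.getD_eq_getElem _ _ (hlen i)]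
        exact hfr0.lt _ (List.getElem_mem _)

section Partite

variable {J : Type*} {r : J → Type w}

/-- A dual relational system on `X`: for every relation symbol `j`, a set of functions from `X` to
the arity of `j`. -/
abbrev DualRel (r : J → Type w) (X : Type*) := ∀ j, Set (X → r j)

/-- `f : X → Y` preserves and reflects dual relations, which are pulled back along `f`. -/
def IsDualHom {X Y : Type*} (S : DualRel r X) (T : DualRel r Y) (f : X → Y) : Prop :=
  ∀ j (η : Y → r j), η ∈ T j ↔ η ∘ f ∈ S j

theorem IsDualHom.comp {X Y Z : Type*} {S : DualRel r X} {T : DualRel r Y} {U : DualRel r Z}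
    {f : X → Y} {g : Y → Z} (hg : IsDualHom T U g) (hf : IsDualHom S T f) :
    IsDualHom S U (g ∘ f) :=
  fun j η => (hg j η).trans (hf j (η ∘ g))

/-- The dual relational system generated by a family of functions to a system. -/
def DualRel.induced {I X Y : Type*} (T : DualRel r Y) (p : I → X → Y) : DualRel r X :=
  fun _ => {ζ | ∃ i, ∃ η ∈ T _, ζ = η ∘ p i}

theorem DualRel.isDualHom_induced {I X Y : Type*} {T : DualRel r Y} {p : I → X → Y}
    (h : ∀ i i' j (η η' : Y → r j), η ∘ p i = η' ∘ p i' → η ∈ T j → η' ∈ T j) (i : I) :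
    IsDualHom (T.induced p) T (p i) := by
  refine fun j η => ⟨fun hη => ⟨i, η, hη, rfl⟩, ?_⟩
  rintro ⟨i', η', hη', e⟩
  exact h i' i j η' η e.symm hη'

/-- The partite lemma: the colour of `f ∘ p` does not depend on `f`, as long as `f` is a
homomorphism extending the given function `g`. -/
theorem exists_partite_step {N : Type} {X A : Type u} [Finite N] [Finite X] [Finite A]
    (S : DualRel r X) (T : DualRel r A) (a : N → X) {g : N → A} (hg : Function.Surjective g)
    (κ : Type v) [Finite κ] :
    ∃ (X' : Type u) (_ : Finite X') (S' : DualRel r X') (a' : N → X'), ∀ χ : (X' → A) → κ,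
      ∃ p : X' → X, IsDualHom S' S p ∧ p ∘ a' = a ∧ ∀ f f', IsDualHom S T f → IsDualHom S T f' →
        f ∘ a = g → f' ∘ a = g → χ (f ∘ p) = χ (f' ∘ p) := by
  obtain ⟨s, hs⟩ := hg.hasRightInverse
  obtain ⟨I, _, hI⟩ := Combinatorics.Line.exists_mono_in_high_dimension
    {f : X → A // IsDualHom S T f ∧ f ∘ a = g} κ
  let p : Combinatorics.Line {f : X → A // IsDualHom S T f ∧ f ∘ a = g} I → N ⊕ (I × X) → X :=
    fun l => Sum.elim a fun z => match l.idxFun z.1 with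
      | none => z.2
      | some f => a (s (f.1 z.2))
  have key : ∀ l l' j (η η' : X → r j), η ∘ p l = η' ∘ p l' →
      η = η' ∨ (η ∈ S j ↔ (η' ∘ a ∘ s) ∈ T j) := by
    intro l l' j η η' e
    obtain ⟨i, hi⟩ := l.proper
    cases hi' : l'.idxFun i with
    | none =>
      left
      funext x
      simpa [p, hi, hi'] using congrFun e (Sum.inr (i, x))
    | some f =>
      right
      have : η = (η' ∘ a ∘ s) ∘ f.1 := by
        funext x
        simpa [p, hi, hi'] using congrFun e (Sum.inr (i, x))
      rw [this, ← f.2.1]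
  refine ⟨N ⊕ (I × X), inferInstance, S.induced p, Sum.inl, fun χ => ?_⟩
  obtain ⟨l, c, hl⟩ := hI fun x => χ (Sum.elim g fun z => (x z.1).1 z.2)
  have hlc : ∀ f, IsDualHom S T f → f ∘ a = g → χ (f ∘ p l) = c := by
    intro f hf hfa
    rw [← hl ⟨f, hf, hfa⟩]
    congr 1
    funext z
    rcases z with n | ⟨i, x⟩
    · exact congrFun hfa n
    · cases h : l.idxFun i with
      | none => simp [p, h]
      | some f' =>
        simp only [p, h, Function.comp, Sum.elim_inr, Combinatorics.Line.apply_some h]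
        exact (congrFun hfa _).trans (hs _)
  refine ⟨p l, DualRel.isDualHom_induced ?_ l, rfl, fun f f' hf hf' hfa hfa' =>
    (hlc f hf hfa).trans (hlc f' hf' hfa').symm⟩
  intro l l' j η η' e hη
  have ea : η ∘ a = η' ∘ a := funext fun n => congrFun e (Sum.inl n)
  rcases key l l' j η η' e with rfl | h1
  · exact hη
  rcases key l' l j η' η e.symm with rfl | h2
  · exact hη
  have : η ∘ a ∘ s = η' ∘ a ∘ s := congrArg (· ∘ s) ea
  rwa [h2, this, ← h1]

theorem exists_partite_construction {N : Type} {X A : Type u} [Finite N] [Finite X] [Finite A]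
    (S : DualRel r X) (T : DualRel r A) (a : N → X) (κ : Type v) [Finite κ]
    (G : Finset (N → A)) (hG : ∀ g ∈ G, Function.Surjective g) :
    ∃ (X' : Type u) (_ : Finite X') (S' : DualRel r X') (a' : N → X'), ∀ χ : (X' → A) → κ,
      ∃ p : X' → X, IsDualHom S' S p ∧ p ∘ a' = a ∧ ∀ g ∈ G, ∀ f f', IsDualHom S T f →
        IsDualHom S T f' → f ∘ a = g → f' ∘ a = g → χ (f ∘ p) = χ (f' ∘ p) := by
  classical
  induction G using Finset.induction_on with
  | empty => exact ⟨X, inferInstance, S, a, fun χ => ⟨id, fun _ _ => Iff.rfl, rfl, by simp⟩⟩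
  | insert g G _ ih =>
    obtain ⟨X₁, _, S₁, a₁, h₁⟩ := ih fun g' hg' => hG g' (Finset.mem_insert_of_mem hg')
    obtain ⟨X₂, _, S₂, a₂, h₂⟩ :=
      exists_partite_step S₁ T a₁ (hG g (Finset.mem_insert_self _ _)) κ
    refine ⟨X₂, inferInstance, S₂, a₂, fun χ => ?_⟩
    obtain ⟨p₂, hp₂, ha₂, hχ₂⟩ := h₂ χ
    obtain ⟨p₁, hp₁, ha₁, hχ₁⟩ := h₁ fun f => χ (f ∘ p₂)
    refine ⟨p₁ ∘ p₂, hp₁.comp hp₂, by rw [Function.comp_assoc, ha₂, ha₁], ?_⟩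
    intro g' hg' f f' hf hf' hfa hfa'
    rcases Finset.mem_insert.1 hg' with rfl | hg'
    · exact hχ₂ _ _ (hf.comp hp₁) (hf'.comp hp₁) (by rw [Function.comp_assoc, ha₁, hfa])
        (by rw [Function.comp_assoc, ha₁, hfa'])
    · exact hχ₁ g' hg' f f' hf hf' hfa hfa'

/-- The dual Ramsey theorem for dual relational systems. The finite linear order and the system
are on different sets, connected by a function. -/
theorem exists_dualRel_ramsey {A B : Type u} [LinearOrder A] [LinearOrder B] [Finite A] [Finite B]
    [Nonempty A] [Nonempty B] (S : DualRel r A) (T : DualRel r B) (κ : Type v) [Finite κ] :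
    ∃ (n : ℕ) (X : Type u) (_ : Finite X) (U : DualRel r X) (a : Fin n → X),
      ∀ χ : (X → A) → κ, ∃ f : X → B, IsDualHom U T f ∧ IsRigidSurjection (f ∘ a) ∧
        ∃ c, ∀ h : B → A, IsDualHom T S h → IsRigidSurjection h → χ (h ∘ f) = c := by
  classical
  obtain ⟨n, hn⟩ := exists_rigidSurjection_mono A B κ
  let b₀ : B := Classical.arbitrary B
  let p : {f : Fin n → B // IsRigidSurjection f} →
      Fin n ⊕ ({f : Fin n → B // IsRigidSurjection f} × B) → B :=
    fun f => Sum.elim f.1 fun z => if z.1 = f then z.2 else b₀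
  have hp : ∀ f, IsDualHom (T.induced p) T (p f) := by
    refine DualRel.isDualHom_induced ?_
    intro f f' j η η' e hη
    by_cases hff : f = f'
    · subst hff
      have : η = η' := by
        funext b
        simpa [p] using congrFun e (Sum.inr (f, b))
      rwa [← this]
    · have h1 : ∀ b, η b = η' b₀ := fun b => by
        simpa [p, hff] using congrFun e (Sum.inr (f, b))
      have h2 : ∀ b, η b₀ = η' b := fun b => by
        simpa [p, Ne.symm hff] using congrFun e (Sum.inr (f', b))
      have : η = η' := by
        funext b
        rw [← h2 b, h1 b, h1 b₀]
      rwa [← this]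
  have := Fintype.ofFinite (Fin n → A)
  obtain ⟨X, _, U, a, h⟩ := exists_partite_construction (T.induced p) S
    (Sum.inl : Fin n → Fin n ⊕ ({f : Fin n → B // IsRigidSurjection f} × B)) κ
    (Finset.univ.filter fun g : Fin n → A => IsRigidSurjection g)
    (fun g hg => (Finset.mem_filter.1 hg).2.1)
  refine ⟨n, X, inferInstance, U, a, fun χ => ?_⟩
  obtain ⟨q, hq, hqa, hχ⟩ := h χ
  let χ' : (Fin n → A) → κ := fun g =>
    if hg : ∃ f, IsDualHom (T.induced p) S f ∧ f ∘ Sum.inl = g then χ (hg.choose ∘ q)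
    else χ fun _ => Classical.arbitrary A
  obtain ⟨f, hf, c, hc⟩ := hn χ'
  refine ⟨p ⟨f, hf⟩ ∘ q, (hp _).comp hq, by rw [Function.comp_assoc, hqa]; exact hf, c, ?_⟩
  intro k hk hkr
  have hex : ∃ f', IsDualHom (T.induced p) S f' ∧ f' ∘ Sum.inl = k ∘ f :=
    ⟨k ∘ p ⟨f, hf⟩, hk.comp (hp _), rfl⟩
  rw [← hc k hkr]
  simp only [χ', dif_pos hex]
  exact hχ (k ∘ f) (Finset.mem_filter.2 ⟨Finset.mem_univ _, hkr.comp hf⟩) _ _ (hk.comp (hp _))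
    hex.choose_spec.1 rfl hex.choose_spec.2

end Partite

/-- A finite type with a sequence in it can be ordered such that functions are rigid surjections if
their restrictions to the sequence are. -/
theorem exists_linearOrder_isRigidSurjection {Z : Type u} [Finite Z] {n : ℕ} (e : Fin n → Z) :
    ∃ _ : LinearOrder Z, ∀ (Y : Type u) [LinearOrder Y] (f : Z → Y),
      IsRigidSurjection (f ∘ e) → IsRigidSurjection f := by
  classical
  have := Fintype.ofFinite Z
  let l : List Z := List.ofFn e ++ Finset.univ.toList
  have hmem : ∀ z, z ∈ l := by simp [l]
  have hl : ∀ i : Fin n, ∃ h : (i : ℕ) < l.length, l[(i : ℕ)] = e i := by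
    intro i
    refine ⟨by simp [l]; omega, ?_⟩
    simp only [l]
    rw [List.getElem_append_left (by simp)]
    simp
  have hidx : ∀ i z, (∀ i' ≤ i, e i' ≠ z) → l.idxOf (e i) < l.idxOf z := by
    intro i z h
    obtain ⟨hi, hle⟩ := hl i
    have h1 : l.idxOf (e i) ≤ i := by
      by_contra! h1
      simpa [hle] using List.not_of_lt_findIdx h1
    refine h1.trans_lt ?_
    by_contra! h2
    have h3 : l.idxOf z < n := by omega
    refine h ⟨l.idxOf z, h3⟩ h2 ?_
    obtain ⟨h4, h5⟩ := hl ⟨l.idxOf z, h3⟩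
    rw [← h5]
    exact List.getElem_idxOf _
  let o : LinearOrder Z := LinearOrder.lift' (fun z => l.idxOf z)
    fun x y h => (List.idxOf_inj (hmem x)).1 h
  have hlt : ∀ i z, (∀ i' ≤ i, e i' ≠ z) → e i < z := hidx
  refine ⟨o, fun Y _ f hf => ?_⟩
  rw [isRigidSurjection_iff] at hf ⊢
  refine ⟨hf.1.of_comp, fun z y hy => ?_⟩
  by_cases hz : ∃ k : ℕ, ∃ hk : k < n, e ⟨k, hk⟩ = z
  · obtain ⟨hk, hkz⟩ := Nat.find_spec hz
    obtain ⟨i, hi, rfl⟩ := hf.2 ⟨_, hk⟩ y (by simpa [hkz] using hy)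
    refine ⟨e i, hlt i z fun i' hi' h => ?_, rfl⟩
    exact Nat.find_min hz (m := i') (lt_of_le_of_lt (show (i' : ℕ) ≤ i from hi') hi) ⟨i'.2, h⟩
  · obtain ⟨i, rfl⟩ := hf.1 y
    exact ⟨e i, hlt i z fun i' _ h => hz ⟨i', i'.2, h⟩, rfl⟩

section Operations

variable {J : Type*} {r : J → Type w} {J' : Type*} {d s : J' → Type w}

/-- A family of operations on `X`, the operation `j` mapping families indexed by `d j` to families
indexed by `s j`. -/
abbrev Operations (d s : J' → Type w) (X : Type*) := ∀ j, (d j → X) → (s j → X)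

/-- `f` is a rigid surjection that preserves and reflects the dual relations and preserves the
operations. -/
structure IsRigidHom {X Y : Type*} [LinearOrder X] [LinearOrder Y] (S : DualRel r X)
    (T : DualRel r Y) (φ : Operations d s X) (ψ : Operations d s Y) (f : X → Y) : Prop where
  rigid : IsRigidSurjection f
  dualHom : IsDualHom S T f
  map_op : ∀ j γ, ψ j (f ∘ γ) = f ∘ φ j γ

/-- The dual Ramsey theorem for structures with dual relations and operations. -/
theorem exists_rigidHom_ramsey {A B : Type u} [LinearOrder A] [LinearOrder B] [Finite A] [Finite B]
    [Nonempty A] [Nonempty B] (S : DualRel r A) (T : DualRel r B) (φ : Operations d s A)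
    (ψ : Operations d s B) (κ : Type v) [Finite κ] :
    ∃ (Z : Type u) (_ : Finite Z) (_ : LinearOrder Z) (U : DualRel r Z) (θ : Operations d s Z),
      ∀ χ : (Z → A) → κ, ∃ f : Z → B, IsRigidHom U T θ ψ f ∧
        ∃ c, ∀ h : B → A, IsRigidHom T S ψ φ h → χ (h ∘ f) = c := by
  classical
  obtain ⟨n, X, _, U, a, hX⟩ := exists_dualRel_ramsey S T κ
  let ΦA := {g : X → A // IsDualHom U S g ∧ IsRigidSurjection (g ∘ a)}
  let ΦB := {f : X → B // IsDualHom U T f ∧ IsRigidSurjection (f ∘ a)}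
  let H := {h : B → A // IsRigidHom T S ψ φ h}
  let c : H → ΦB → ΦA := fun h f => ⟨h.1 ∘ f.1, h.2.dualHom.comp f.2.1, h.2.rigid.comp f.2.2⟩
  let Z := {z : (ΦA → A) × (ΦB → B) // ∀ h f, h.1 (z.2 f) = z.1 (c h f)}
  let e : X → Z := fun x => ⟨(fun g => g.1 x, fun f => f.1 x), fun _ _ => rfl⟩
  let θ : Operations d s Z := fun j γ y =>
    ⟨(fun g => φ j (fun x => (γ x).1.1 g) y, fun f => ψ j (fun x => (γ x).1.2 f) y), by
      intro h f
      refine (congrFun (h.2.map_op j fun x => (γ x).1.2 f) y).symm.trans ?_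
      refine congrFun (congrArg (φ j) (funext fun x => ?_)) y
      exact (γ x).2 h f⟩
  obtain ⟨_, ho⟩ := exists_linearOrder_isRigidSurjection (e ∘ a)
  let V : DualRel r Z := fun j => {ζ | ζ ∘ e ∈ U j}
  refine ⟨Z, inferInstance, inferInstance, V, θ, fun χ => ?_⟩
  obtain ⟨f, hf, hfa, k, hk⟩ := hX fun g =>
    if hg : IsDualHom U S g ∧ IsRigidSurjection (g ∘ a) then χ fun z => z.1.1 ⟨g, hg⟩
    else χ fun _ => Classical.arbitrary A
  refine ⟨fun z => z.1.2 ⟨f, hf, hfa⟩, ⟨ho B _ hfa, fun j η => hf j η, fun j γ => rfl⟩, k, ?_⟩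
  intro h hh
  have hg : IsDualHom U S (h ∘ f) ∧ IsRigidSurjection ((h ∘ f) ∘ a) :=
    ⟨hh.dualHom.comp hf, hh.rigid.comp hfa⟩
  rw [← hk h hh.dualHom hh.rigid, dif_pos hg]
  congr 1
  funext z
  exact z.2 ⟨h, hh⟩ ⟨f, hf, hfa⟩

end Operations

namespace CatLanguage

variable {L : CatLanguage.{v, w} FintypeCat.{u}ᵒᵖ}

/-- The dual relations of a structure on a finite type. -/
def StructureOn.dualRel {X : FintypeCat.{u}} (A : L.StructureOn (op X)) :
    DualRel (fun R => (L.relArity R).unop.obj) X.obj :=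
  fun R => {η | (FintypeCat.homMk (X := X) (Y := (L.relArity R).unop) η).op ∈ A.rel R}

/-- The operations of a structure on a finite type. -/
def StructureOn.operations {X : FintypeCat.{u}} (A : L.StructureOn (op X)) :
    Operations (fun F => (L.funcArity F).1.unop.obj) (fun F => (L.funcArity F).2.unop.obj) X.obj :=
  fun F γ => (A.func F (FintypeCat.homMk (X := (L.funcArity F).1.unop) (Y := X) γ).op).unop

/-- The structure with given dual relations and operations. -/
def StructureOn.ofDual {X : FintypeCat.{u}}
    (S : DualRel (fun R => (L.relArity R).unop.obj) X.obj)
    (φ : Operations (fun F => (L.funcArity F).1.unop.obj) (fun F => (L.funcArity F).2.unop.obj)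
      X.obj) : L.StructureOn (op X) where
  rel R := {η | (fun x => η.unop x) ∈ S R}
  func F γ := (FintypeCat.homMk (X := (L.funcArity F).2.unop) (Y := X) (φ F fun x => γ.unop x)).op

theorem isHom_homMk_iff {X Y : FintypeCat.{u}} {A : L.StructureOn (op X)}
    {B : L.StructureOn (op Y)} {f : Y.obj → X.obj} :
    IsHom A B (FintypeCat.homMk f).op ↔
      IsDualHom B.dualRel A.dualRel f ∧
        ∀ F γ, A.operations F (f ∘ γ) = f ∘ B.operations F γ := by
  constructor
  · intro h
    refine ⟨fun R η => h.rel_iff R (FintypeCat.homMk η).op, fun F γ => ?_⟩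
    funext x
    exact congrArg (fun k => k.unop x) (h.func_eq F (FintypeCat.homMk γ).op)
  · intro h
    refine ⟨fun R η => h.1 R fun x => η.unop x, fun F γ => ?_⟩
    apply Quiver.Hom.unop_inj
    apply FintypeCat.hom_ext
    intro x
    exact congrFun (h.2 F fun x => γ.unop x) x

/-- The function underlying a morphism of structures on finite linear orders. -/
def StrCat.toFun {K M : StrCat L dualForgetOrder.{u}} (f : K ⟶ M) :
    M.base.unop.carrier → K.base.unop.carrier :=
  fun x => f.1.unop x

/-- The property of the functions underlying morphisms. -/
abbrev StrCat.IsMor (K M : StrCat L dualForgetOrder.{u})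
    (f : M.base.unop.carrier → K.base.unop.carrier) : Prop :=
  IsRigidHom (X := M.base.unop.carrier) (Y := K.base.unop.carrier)
    (StructureOn.dualRel (X := FintypeCat.of M.base.unop.carrier) M.str)
    (StructureOn.dualRel (X := FintypeCat.of K.base.unop.carrier) K.str)
    (StructureOn.operations (X := FintypeCat.of M.base.unop.carrier) M.str)
    (StructureOn.operations (X := FintypeCat.of K.base.unop.carrier) K.str) f

theorem StrCat.isMor_toFun {K M : StrCat L dualForgetOrder.{u}} (f : K ⟶ M) :
    StrCat.IsMor K M (StrCat.toFun f) := by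
  obtain ⟨f, ⟨i, rfl⟩, hf⟩ := f
  obtain ⟨h1, h2⟩ := isHom_homMk_iff.1 hf
  exact ⟨i.unop.2, h1, h2⟩

/-- The morphism with a given underlying function. -/
def StrCat.homMk {K M : StrCat L dualForgetOrder.{u}}
    (f : M.base.unop.carrier → K.base.unop.carrier) (hf : StrCat.IsMor K M f) : K ⟶ M :=
  ⟨(FintypeCat.homMk (X := FintypeCat.of M.base.unop.carrier)
      (Y := FintypeCat.of K.base.unop.carrier) f).op,
    ⟨Quiver.Hom.op (X := M.base.unop) (Y := K.base.unop) ⟨f, hf.rigid⟩, rfl⟩,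
    isHom_homMk_iff.2 ⟨hf.dualHom, hf.map_op⟩⟩

theorem StrCat.hom_ext {K M : StrCat L dualForgetOrder.{u}} {f g : K ⟶ M}
    (h : StrCat.toFun f = StrCat.toFun g) : f = g := by
  apply Subtype.ext
  apply Quiver.Hom.unop_inj
  apply FintypeCat.hom_ext
  exact fun x => congrFun h x

end CatLanguage

theorem corollary7 (L : CatLanguage.{v, w} FintypeCat.{u}ᵒᵖ) :
    HasRamseyProperty (CatLanguage.StrCat L dualForgetOrder.{u}) := by
  classical
  intro A B k hk
  rcases isEmpty_or_nonempty (A ⟶ B) with hAB | ⟨⟨h₀⟩⟩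
  · exact ⟨B, fun χ => ⟨𝟙 B, ⟨0, hk⟩, by rintro _ ⟨g, rfl⟩; exact hAB.elim g⟩⟩
  rcases isEmpty_or_nonempty A.base.unop.carrier with hA | hA
  · refine ⟨B, fun χ => ⟨𝟙 B, χ h₀, ?_⟩⟩
    rintro _ ⟨g, rfl⟩
    congr 1
    exact CatLanguage.StrCat.hom_ext (funext fun x => hA.elim (CatLanguage.StrCat.toFun g x))
  have hB : Nonempty B.base.unop.carrier :=
    (CatLanguage.StrCat.isMor_toFun h₀).rigid.1.nonempty
  obtain ⟨Z, _, _, U, θ, hZ⟩ := exists_rigidHom_ramsey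
    (CatLanguage.StructureOn.dualRel (X := FintypeCat.of A.base.unop.carrier) A.str)
    (CatLanguage.StructureOn.dualRel (X := FintypeCat.of B.base.unop.carrier) B.str)
    (CatLanguage.StructureOn.operations (X := FintypeCat.of A.base.unop.carrier) A.str)
    (CatLanguage.StructureOn.operations (X := FintypeCat.of B.base.unop.carrier) B.str) (Fin k)
  let Z' : CatLanguage.StrCat L dualForgetOrder.{u} :=
    ⟨op ⟨Z⟩, CatLanguage.StructureOn.ofDual (X := FintypeCat.of Z) U θ⟩
  refine ⟨Z', fun χ => ?_⟩
  obtain ⟨f, hf, c, hc⟩ := hZ fun g =>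
    if hg : CatLanguage.StrCat.IsMor A Z' g then χ (CatLanguage.StrCat.homMk g hg) else ⟨0, hk⟩
  refine ⟨CatLanguage.StrCat.homMk (K := B) (M := Z') f hf, c, ?_⟩
  rintro _ ⟨g, rfl⟩
  rw [← hc _ (CatLanguage.StrCat.isMor_toFun g)]
  have hgf : CatLanguage.StrCat.IsMor A Z' (CatLanguage.StrCat.toFun g ∘ f) :=
    CatLanguage.StrCat.isMor_toFun (g ≫ CatLanguage.StrCat.homMk (K := B) (M := Z') f hf)
  rw [dif_pos hgf]
  rfl
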